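/- **Conventions.** Let $X$ be a metric space. A ball is a center $x\in X$ together with a radius $r=\mathrm{rad}(B)\in(0,\infty)$, and is either the open ball $B(x,r)=\{y: d(x,y)<r\}$ or the closed ball $\overline B(x,r)=\{y: d(x,y)\le r\}$; "ball" without qualification means either kind, and inclusions between balls are inclusions of the point sets. For a collection $\mathcal B$ of balls, $\bigcup\mathcal B$ is the union of its balls, $\mathrm{rad}(\mathcal B)=\sup_{B\in\mathcal B}\mathrm{rad}(B)$ and $\mathcal B|^A_r=\{B\in\mathcal B:\ \mathrm{rad}(B)\le r,\ B\subset A\}$. A gauge function $\xi$ assigns to every ball a number in $(0,\infty)$, with the same value on the open and the closed ball of the same center and radius. It is $D$-doubling if $D^{-1}\xi(B)\le\xi(B')\le D\xi(B)$ for all open balls $B\subset B'$ with $\mathrm{rad}(B)\le\mathrm{rad}(B')\le 2\,\mathrm{rad}(B)$. For gauge functions $\nu,\xi$ write $\nu\ll\xi$ if $\nu(B)/\xi(B)\le\nu(B')/\xi(B')$ for all balls $B\subset B'$ with $\mathrm{rad}(B)\le\mathrm{rad}(B')$. The Hausdorff content of $A\subset X$ is $$\mathcal H^\xi_r(A)=\inf\Big\{\sum_{c\in\mathcal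 C}\xi(c):\ \mathcal C \text{ a collection of open balls},\ \mathrm{rad}(\mathcal C)\le r,\ A\subset\bigcup\mathcal C\Big\}\in[0,\infty].$$ For a set $E$ and a ball $B$ write $E\succ_{\xi,\nu}B$ if $\mathcal H^\xi_{\mathrm{rad}(B)}(E\cap B)\ge\nu(B)$; for a collection $\mathcal E$ of sets and a collection $\mathcal B$ of balls write $\mathcal E\succ_{\xi,\nu}\mathcal B$ if for every $B\in\mathcal B$ there is $E\in\mathcal E$ with $E\succ_{\xi,\nu}B$. For a nested sequence $(\mathcal E_i)$ of collections of sets, $\limsup_{i\to\infty}\mathcal E_i=\{x:\ \forall i\in\mathbb N\ \exists E\in\mathcal E_i,\ x\in E\}$. **Theorem.** Let $X$ be a complete metric space and let $\xi,\nu$ be two $D$-doubling gauge functions on $X$ with $\nu\ll\xi$. For every $\Delta>0$ there is $\beta>0$ such that the following holds. Let $(\mathcal E_i)_{i\in\mathbb N}$ be collections of open subsets of $X$ with $\mathcal E_i\subset\mathcal E_j$ for $i\ge j$, and let $(\mathcal B_i)_{i\in\mathbb N}$ be collections of closed balls with $\mathcal B_i\subset\mathcal B_j$ for $i\ge j$,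 $\mathcal E_i\succ_{\xi,\nu}\mathcal B_i$ for every $i$, and $\lim_{i\to\infty}\mathrm{rad}(\mathcal B_i)=0$. Let $U\subset X$ be open and suppose that for every ball $B\subset U$ and every $i\in\mathbb N$ $$\mathcal H^\nu_{\mathrm{rad}(B)}\Big(\bigcup\mathcal B_i|^B_{\mathrm{rad}(B)}\Big)\ge\Delta\,\nu(B).$$ Then for every ball $B\subset U$ $$\mathcal H^\xi_{\mathrm{rad}(B)}\Big(\limsup_{i\to\infty}\mathcal E_i\cap B\Big)\ge\beta\,\xi(B).$$ -/

import Mathlib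

open scoped ENNReal

/-- A ball of a metric space: a center, a positive radius, and the information whether it is the
open or the closed ball. Different data may give the same point set. -/
structure MetricBall (X : Type*) where
  center : X
  radius : ℝ
  radius_pos : 0 < radius
  isClosed : Bool

namespace MetricBall

variable {X : Type*} [MetricSpace X]

/-- The point set of a ball. -/
def carrier (B : MetricBall X) : Set X :=
  if B.isClosed then Metric.closedBall B.center B.radius else Metric.ball B.center B.radius

/-- The union of a collection of balls. -/
def sUnion (𝓑 : Set (MetricBall X)) : Set X := ⋃ B ∈ 𝓑, B.carrier

/-- The supremum of the radii of the balls in a collection (`0` for the empty collection). -/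
noncomputable def rad (𝓑 : Set (MetricBall X)) : ℝ≥0∞ := ⨆ B ∈ 𝓑, ENNReal.ofReal B.radius

/-- The balls of the collection that have radius at most `r` and are contained in `A`. -/
def restrict (𝓑 : Set (MetricBall X)) (A : Set X) (r : ℝ) : Set (MetricBall X) :=
  {B ∈ 𝓑 | B.radius ≤ r ∧ B.carrier ⊆ A}

end MetricBall

/-- A gauge function: a positive finite number for every ball, the same for the open and the closed
ball with the same center and radius. -/
structure Gauge (X : Type*) where
  toFun : MetricBall X → ℝ
  pos : ∀ B, 0 < toFun B
  open_eq_closed : ∀ (x : X) (r : ℝ) (hr : 0 < r),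
    toFun ⟨x, r, hr, false⟩ = toFun ⟨x, r, hr, true⟩

namespace Gauge

variable {X : Type*} [MetricSpace X]

instance : CoeFun (Gauge X) (fun _ => MetricBall X → ℝ) := ⟨Gauge.toFun⟩

/-- `ξ` is `D`-doubling. -/
def IsDoubling (ξ : Gauge X) (D : ℝ) : Prop :=
  ∀ B B' : MetricBall X, B.isClosed = false → B'.isClosed = false →
    B.carrier ⊆ B'.carrier → B.radius ≤ B'.radius → B'.radius ≤ 2 * B.radius →
      D⁻¹ * ξ B ≤ ξ B' ∧ ξ B' ≤ D * ξ B

/-- `ν ≪ ξ`, that is, `ξ` dominates `ν`; the balls may be open or closed. -/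
def DominatedBy (ν ξ : Gauge X) : Prop :=
  ∀ B B' : MetricBall X, B.carrier ⊆ B'.carrier → B.radius ≤ B'.radius →
    ν B / ξ B ≤ ν B' / ξ B'

/-- The spherical Hausdorff content of `A` at scale `r`: the infimum of `∑ ξ(c)` over all
collections of open balls of radius at most `r` that cover `A`. -/
noncomputable def content (ξ : Gauge X) (r : ℝ) (A : Set X) : ℝ≥0∞ :=
  ⨅ (𝓒 : Set (MetricBall X)) (_ : ∀ c ∈ 𝓒, c.isClosed = false ∧ c.radius ≤ r)
    (_ : A ⊆ MetricBall.sUnion 𝓒), ∑' c : 𝓒, ENNReal.ofReal (ξ c)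

/-- The ball `B` is a `(ξ, ν)`-transfer ball for the set `E`. -/
def IsTransferBall (ξ ν : Gauge X) (E : Set X) (B : MetricBall X) : Prop :=
  ENNReal.ofReal (ν B) ≤ ξ.content B.radius (E ∩ B.carrier)

/-- Every ball of `𝓑` is a `(ξ, ν)`-transfer ball for some member of `𝓔`. -/
def IsTransferCollection (ξ ν : Gauge X) (𝓔 : Set (Set X)) (𝓑 : Set (MetricBall X)) : Prop :=
  ∀ B ∈ 𝓑, ∃ E ∈ 𝓔, ξ.IsTransferBall ν E B

end Gauge

/-- The limsup set of a (nested) sequence of collections of sets. -/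
def limsupCollections {X : Type*} (𝓔 : ℕ → Set (Set X)) : Set X :=
  {x | ∀ i, ∃ E ∈ 𝓔 i, x ∈ E}

/-! Suppose a cover of `limsupCollections 𝓔 ∩ B` has `ξ`-mass below `β ξ(B)`. Nested closed balls
are built with an invariant: the cover members meeting the current ball have radius at most its
radius and total mass below `β` times its gauge. The (n+1)-st ball lies in a member of `𝓔 n`, and
radii at least halve. By completeness the balls share a point, which lies in the limsup set; a cover
member containing it meets every ball, so its radius is at most every one of theirs, which is
absurd.

The refinement step `exists_closedBall_subset_of_mass_lt` is by contradiction. If no smaller ball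
inherits the invariant, consider tiny balls of `𝓑 j`. Those near a cover member of comparable or
larger size lie in enlarged members, whose `ν`-content is small because `ν ≪ ξ`
(`content_iUnion_ball_le`). For any other, the transfer property and the failure of the invariant
bound its `ν`-gauge by a constant times the mass of nearby members (`content_inter_closedBall_le`).
These members are tiny, and the small members of a finite-mass cover carry arbitrarily little mass.
So the content of the union falls below the assumed lower bound. -/

namespace Gauge

open Metric Set

variable {X : Type*}

/-! ### Doubling and domination -/

/-- The value of a gauge on the ball with center `x` and radius `r`, extended by the value `1` to
nonpositive radii. -/
noncomputable def val (ξ : Gauge X) (x : X) (r : ℝ) : ℝ :=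
  if h : 0 < r then ξ.toFun ⟨x, r, h, false⟩ else 1

lemma apply_eq_val (ξ : Gauge X) (B : MetricBall X) : ξ.toFun B = ξ.val B.center B.radius := by
  obtain ⟨x, r, hr, b⟩ := B
  cases b
  · simp [val, hr]
  · simp [val, hr, ξ.open_eq_closed]

lemma val_pos (ξ : Gauge X) (x : X) (r : ℝ) : 0 < ξ.val x r := by
  unfold val
  split_ifs
  · exact ξ.pos _
  · exact one_pos

variable [MetricSpace X] {ξ ν η : Gauge X} {D : ℝ}

lemma IsDoubling.one_le (hξ : ξ.IsDoubling D) (x : X) : 1 ≤ D := by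
  have h := (hξ ⟨x, 1, one_pos, false⟩ ⟨x, 1, one_pos, false⟩ rfl rfl subset_rfl le_rfl
    (by norm_num)).2
  have hp := ξ.pos ⟨x, 1, one_pos, false⟩
  exact le_of_mul_le_mul_right (by simpa using h) hp

lemma IsDoubling.val_le (hξ : ξ.IsDoubling D) {x y : X} {r s : ℝ} (hr : 0 < r)
    (hsub : ball x r ⊆ ball y s) (hrs : r ≤ s) (hs : s ≤ 2 * r) :
    ξ.val x r ≤ D * ξ.val y s ∧ ξ.val y s ≤ D * ξ.val x r := by
  have hD : 0 < D := one_pos.trans_le (hξ.one_le x)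
  have h := hξ ⟨x, r, hr, false⟩ ⟨y, s, hr.trans_le hrs, false⟩ rfl rfl
    (by simpa [MetricBall.carrier] using hsub) hrs hs
  simp only [apply_eq_val] at h
  rwa [inv_mul_le_iff₀ hD] at h

lemma IsDoubling.val_le_pow (hξ : ξ.IsDoubling D) (x : X) (n : ℕ) :
    ∀ {r s : ℝ}, 0 < r → r ≤ s → s ≤ 2 ^ n * r →
      ξ.val x r ≤ D ^ n * ξ.val x s ∧ ξ.val x s ≤ D ^ n * ξ.val x r := by
  have hD := hξ.one_le x
  have hD0 : 0 ≤ D := zero_le_one.trans hD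
  induction n with
  | zero =>
    intro r s _ hrs hs
    obtain rfl : r = s := le_antisymm hrs (by simpa using hs)
    simp
  | succ n ih =>
    intro r s hr hrs hs
    rcases le_total s (2 * r) with h | h
    · have hpow : D ≤ D ^ (n + 1) := le_self_pow₀ hD (Nat.succ_ne_zero n)
      obtain ⟨h1, h2⟩ := hξ.val_le hr (ball_subset_ball hrs : ball x r ⊆ ball x s) hrs h
      exact ⟨h1.trans (mul_le_mul_of_nonneg_right hpow (ξ.val_pos _ _).le),
        h2.trans (mul_le_mul_of_nonneg_right hpow (ξ.val_pos _ _).le)⟩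
    · obtain ⟨h1, h2⟩ := ih (s := s / 2) hr (by linarith) (by rw [pow_succ] at hs; linarith)
      obtain ⟨h3, h4⟩ := hξ.val_le (x := x) (y := x) (r := s / 2) (s := s) (by linarith)
        (ball_subset_ball (by linarith)) (by linarith) (by linarith)
      have hp : 0 ≤ D ^ n := pow_nonneg hD0 n
      constructor
      · calc ξ.val x r ≤ D ^ n * ξ.val x (s / 2) := h1
          _ ≤ D ^ n * (D * ξ.val x s) := mul_le_mul_of_nonneg_left h3 hp
          _ = D ^ (n + 1) * ξ.val x s := by ring
      · calc ξ.val x s ≤ D * ξ.val x (s / 2) := h4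
          _ ≤ D * (D ^ n * ξ.val x r) := mul_le_mul_of_nonneg_left h2 hD0
          _ = D ^ (n + 1) * ξ.val x r := by ring

/-- Nearby balls of comparable radius have comparable gauge. -/
lemma IsDoubling.val_le_of_dist_le (hξ : ξ.IsDoubling D) {x y : X} {r R : ℝ} (hR : 0 < R)
    (hr : R ≤ 16 * r) (hrR : r ≤ R) (hxy : dist y x ≤ 2 * R) :
    ξ.val x R ≤ D ^ 12 * ξ.val y r := by
  have hr0 : 0 < r := by linarith
  have hD0 : 0 ≤ D := zero_le_one.trans (hξ.one_le x)
  have h1 := (hξ.val_le_pow x 5 (r := R) (s := 32 * r) hR (by linarith) (by linarith)).1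
  have h2 := (hξ.val_le (x := x) (y := y) (r := 32 * r) (s := 64 * r) (by linarith)
    (ball_subset_ball' (by rw [dist_comm]; linarith)) (by linarith) (by linarith)).1
  have h3 := (hξ.val_le_pow y 6 (r := r) (s := 64 * r) hr0 (by linarith) (by linarith)).2
  calc ξ.val x R ≤ D ^ 5 * ξ.val x (32 * r) := h1
    _ ≤ D ^ 5 * (D * (D ^ 6 * ξ.val y r)) := by gcongr; exact h2.trans (by gcongr)
    _ = D ^ 12 * ξ.val y r := by ring

/-- The ball of radius `4 * R` about `x` contains the one about `y`; passing from `4 * R` back to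
`R` costs `D ^ 2` for each gauge. -/
lemma DominatedBy.val_mul_le (hdom : ν.DominatedBy ξ) (hξ : ξ.IsDoubling D)
    (hν : ν.IsDoubling D) {x y : X} {r R : ℝ} (hr : 0 < r) (hrR : r ≤ R)
    (hxy : dist y x ≤ 2 * R) :
    ν.val y r ≤ D ^ 4 * (ν.val x R / ξ.val x R) * ξ.val y r := by
  have hR : 0 < R := hr.trans_le hrR
  have hD : 0 < D := one_pos.trans_le (hξ.one_le x)
  have h := hdom ⟨y, r, hr, false⟩ ⟨x, 4 * R, by linarith, false⟩
    (by simpa [MetricBall.carrier] using ball_subset_ball' (by linarith)) (by simp; linarith)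
  simp only [apply_eq_val] at h
  have h1 := (hν.val_le_pow x 2 (r := R) (s := 4 * R) hR (by linarith) (by linarith)).2
  have h2 := (hξ.val_le_pow x 2 (r := R) (s := 4 * R) hR (by linarith) (by linarith)).1
  have p1 := ξ.val_pos x R
  have p2 := ξ.val_pos y r
  have p3 := ξ.val_pos x (4 * R)
  have p4 := ν.val_pos x R
  have h3 : ν.val x (4 * R) / ξ.val x (4 * R) ≤ D ^ 4 * (ν.val x R / ξ.val x R) := by
    rw [← mul_div_assoc, div_le_div_iff₀ p3 p1]
    calc ν.val x (4 * R) * ξ.val x R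
        ≤ (D ^ 2 * ν.val x R) * (D ^ 2 * ξ.val x (4 * R)) := by gcongr
      _ = D ^ 4 * ν.val x R * ξ.val x (4 * R) := by ring
  exact (div_le_iff₀ p2).1 (h.trans h3)

/-! ### Contents and Vitali covering -/

lemma content_mono (ξ : Gauge X) (r : ℝ) {A A' : Set X} (h : A ⊆ A') :
    ξ.content r A ≤ ξ.content r A' :=
  le_iInf fun 𝓒 => le_iInf fun h𝓒 => le_iInf fun hA =>
    iInf_le_of_le 𝓒 (iInf_le_of_le h𝓒 (iInf_le_of_le (h.trans hA) le_rfl))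

lemma content_union_le (ξ : Gauge X) (r : ℝ) (A A' : Set X) :
    ξ.content r (A ∪ A') ≤ ξ.content r A + ξ.content r A' := by
  refine ENNReal.le_iInf_add_iInf fun 𝓒 𝓒' => ENNReal.le_iInf_add_iInf fun h h' =>
    ENNReal.le_iInf_add_iInf fun hA hA' => ?_
  refine iInf_le_of_le (𝓒 ∪ 𝓒') (iInf_le_of_le ?_ (iInf_le_of_le ?_
    (ENNReal.tsum_union_le (fun c => ENNReal.ofReal (ξ c)) 𝓒 𝓒')))
  · rintro c (hc | hc)
    exacts [h c hc, h' c hc]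
  · rw [MetricBall.sUnion, biUnion_union]
    exact union_subset_union hA hA'

lemma content_le_tsum (ξ : Gauge X) {r : ℝ} {A : Set X} {ι : Type*} (x : ι → X) (ρ : ι → ℝ)
    (hρ : ∀ i, 0 < ρ i) (hρr : ∀ i, ρ i ≤ r) (hA : A ⊆ ⋃ i, ball (x i) (ρ i)) :
    ξ.content r A ≤ ∑' i, ENNReal.ofReal (ξ.val (x i) (ρ i)) := by
  let b : ι → MetricBall X := fun i => ⟨x i, ρ i, hρ i, false⟩
  refine iInf_le_of_le (range b) (iInf_le_of_le ?_ (iInf_le_of_le ?_ ?_))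
  · rintro _ ⟨i, rfl⟩
    exact ⟨rfl, hρr i⟩
  · intro a ha
    obtain ⟨i, hi⟩ := mem_iUnion.1 (hA ha)
    exact mem_biUnion (mem_range_self i) (by simpa [MetricBall.carrier, b] using hi)
  · calc ∑' c : range b, ENNReal.ofReal (ξ.toFun c)
        = ∑' c : range b, ENNReal.ofReal (ξ.val (x (rangeSplitting b c))
            (ρ (rangeSplitting b c))) := by
          refine tsum_congr fun c => ?_
          conv_lhs => rw [← apply_rangeSplitting b c, apply_eq_val]
      _ ≤ _ := ENNReal.tsum_comp_le_tsum_of_injective (rangeSplitting_injective b)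
          (fun i => ENNReal.ofReal (ξ.val (x i) (ρ i)))

/-- If every ball of a family is dominated by the mass of nearby members of a collection, then the
content of the union is dominated by the mass of the whole collection. -/
lemma IsDoubling.content_le_mul_tsum (hη : η.IsDoubling D) {ι : Type*} (t : Set ι) (x : ι → X)
    (r : ι → ℝ) {ρ : ℝ} (hr : ∀ a ∈ t, 0 < r a) (hrρ : ∀ a ∈ t, 16 * r a ≤ ρ)
    (w : MetricBall X → ℝ≥0∞) (C : Set (MetricBall X)) (S : ι → Set (MetricBall X))
    (hSC : ∀ a ∈ t, S a ⊆ C) (hS : ∀ a ∈ t, ∀ c ∈ S a, dist c.center (x a) ≤ 3 * r a)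
    (M : ℝ≥0∞) (hM : ∀ a ∈ t, ENNReal.ofReal (η.val (x a) (r a)) ≤ M * ∑' c : S a, w c)
    {A : Set X} (hA : A ⊆ ⋃ a ∈ t, closedBall (x a) (r a)) :
    η.content ρ A ≤ ENNReal.ofReal (D ^ 4) * M * ∑' c : C, w c := by
  -- The tripled balls contain the centers of the members of `S a`, so disjoint tripled balls have
  -- disjoint `S a`. The enlargement 5 · 3 = 15 is rounded up to 16 = 2 ^ 4, whence `D ^ 4`.
  obtain ⟨u, hut, hdisj, hcov⟩ := Vitali.exists_disjoint_subfamily_covering_enlargement_closedBall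
    t x (fun a => 3 * r a) (3 * (ρ / 16)) (fun a ha => by linarith [hrρ a ha]) 5 (by norm_num)
  have hpd : u.PairwiseDisjoint S := by
    intro a ha b hb hab
    refine disjoint_left.2 fun c hca hcb => ?_
    exact disjoint_left.1 (hdisj ha hb hab) (mem_closedBall.2 (hS a (hut ha) c hca))
      (mem_closedBall.2 (hS b (hut hb) c hcb))
  calc η.content ρ A
      ≤ ∑' a : u, ENNReal.ofReal (η.val (x a) (16 * r a)) := by
        refine η.content_le_tsum (fun a : u => x a) (fun a : u => 16 * r a)
          (fun a => by linarith [hr a (hut a.2)]) (fun a => hrρ a (hut a.2)) fun y hy => ?_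
        obtain ⟨a, ha, hya⟩ := mem_iUnion₂.1 (hA hy)
        obtain ⟨b, hb, hab⟩ := hcov a ha
        have hya' : y ∈ closedBall (x a) (3 * r a) :=
          closedBall_subset_closedBall (by linarith [hr a ha]) hya
        refine mem_iUnion.2 ⟨⟨b, hb⟩, ?_⟩
        exact closedBall_subset_ball (by linarith [hr b (hut hb)]) (hab hya')
    _ ≤ ∑' a : u, ENNReal.ofReal (D ^ 4) * M * ∑' c : S a, w c := by
        refine ENNReal.tsum_le_tsum fun a => ?_
        have hra := hr a (hut a.2)
        have hD4 : 0 ≤ D ^ 4 := by positivity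
        have h := (hη.val_le_pow (x a) 4 (r := r a) (s := 16 * r a) hra (by linarith)
          (by linarith)).2
        calc ENNReal.ofReal (η.val (x a) (16 * r a))
            ≤ ENNReal.ofReal (D ^ 4) * ENNReal.ofReal (η.val (x a) (r a)) := by
              rw [← ENNReal.ofReal_mul hD4]
              exact ENNReal.ofReal_le_ofReal h
          _ ≤ _ := by
              rw [mul_assoc]
              gcongr
              exact hM a (hut a.2)
    _ = ENNReal.ofReal (D ^ 4) * M * ∑' c : ⋃ a ∈ u, S a, w c := by
        rw [ENNReal.tsum_mul_left, ENNReal.tsum_biUnion' hpd]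
    _ ≤ _ := by
        exact mul_le_mul_right (ENNReal.tsum_mono_subtype w
          (iUnion₂_subset fun a ha => hSC a (hut ha))) _

end Gauge

/-! ### Members meeting a set, and mass -/

namespace MetricBall

open Metric Set

variable {X : Type*} [MetricSpace X]

lemma carrier_subset_closedBall (c : MetricBall X) : c.carrier ⊆ closedBall c.center c.radius := by
  unfold carrier
  split_ifs
  exacts [subset_rfl, ball_subset_closedBall]

lemma ball_subset_carrier (c : MetricBall X) : ball c.center c.radius ⊆ c.carrier := by
  unfold carrier
  split_ifs
  exacts [ball_subset_closedBall, subset_rfl]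

/-- The balls of a collection that meet a given set. -/
def meeting (C : Set (MetricBall X)) (A : Set X) : Set (MetricBall X) :=
  {c ∈ C | (c.carrier ∩ A).Nonempty}

lemma meeting_mono (C : Set (MetricBall X)) {A A' : Set X} (h : A ⊆ A') :
    meeting C A ⊆ meeting C A' :=
  fun _ hc => ⟨hc.1, hc.2.mono (inter_subset_inter_right _ h)⟩

lemma dist_center_le_of_mem_meeting {C : Set (MetricBall X)} {x : X} {r : ℝ} {c : MetricBall X}
    (hc : c ∈ meeting C (closedBall x r)) : dist c.center x ≤ c.radius + r := by
  obtain ⟨-, z, hz, hzx⟩ := hc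
  have h1 := mem_closedBall'.1 (c.carrier_subset_closedBall hz)
  have h2 := mem_closedBall.1 hzx
  linarith [dist_triangle c.center z x]

end MetricBall

namespace Gauge

open Metric Set MetricBall

variable {X : Type*}

/-- The total gauge of a collection of balls. -/
noncomputable def mass (ξ : Gauge X) (C : Set (MetricBall X)) : ℝ≥0∞ :=
  ∑' c : C, ENNReal.ofReal (ξ c)

lemma mass_mono (ξ : Gauge X) {C C' : Set (MetricBall X)} (h : C ⊆ C') : ξ.mass C ≤ ξ.mass C' :=
  ENNReal.tsum_mono_subtype (fun c => ENNReal.ofReal (ξ c)) h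

lemma le_mass (ξ : Gauge X) {C : Set (MetricBall X)} {c : MetricBall X} (h : c ∈ C) :
    ENNReal.ofReal (ξ c) ≤ ξ.mass C :=
  ENNReal.le_tsum (f := fun c : C => ENNReal.ofReal (ξ c)) ⟨c, h⟩

/-- The balls of small radius carry a small part of a finite mass. -/
lemma exists_mass_le_of_radius_le (ξ : Gauge X) {C : Set (MetricBall X)} (hC : ξ.mass C ≠ ∞)
    {ε : ℝ≥0∞} (hε : 0 < ε) : ∃ δ : ℝ, 0 < δ ∧ ξ.mass {c ∈ C | c.radius ≤ δ} ≤ ε := by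
  obtain ⟨s, hs⟩ := ((ENNReal.tendsto_tsum_compl_atTop_zero hC).eventually
    (gt_mem_nhds hε)).exists
  obtain ⟨δ, hδ, hδs⟩ : ∃ δ : ℝ, 0 < δ ∧ ∀ c ∈ s, δ < c.1.radius := by
    rcases s.eq_empty_or_nonempty with rfl | hne
    · exact ⟨1, one_pos, by simp⟩
    · obtain ⟨c₀, -, hmin⟩ := s.exists_min_image (fun c => c.1.radius) hne
      have := c₀.1.radius_pos
      exact ⟨c₀.1.radius / 2, by linarith, fun c hc => by linarith [hmin c hc]⟩
  refine ⟨δ, hδ, le_trans ?_ hs.le⟩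
  let f : {c ∈ C | c.radius ≤ δ} → {c : C // c ∉ s} := fun c =>
    ⟨⟨c.1, c.2.1⟩, fun hc => (hδs _ hc).not_ge c.2.2⟩
  have hf : Function.Injective f := fun a b h => by
    simpa [f, Subtype.ext_iff] using h
  exact ENNReal.tsum_comp_le_tsum_of_injective hf
    (fun c : {c : C // c ∉ s} => ENNReal.ofReal (ξ c.1.1))

variable [MetricSpace X] {ξ ν : Gauge X} {D : ℝ}

/-! ### Content estimates from mass -/

/-- If every small ball in an open set `E` around a point of a ball either meets a larger member of
`C` or has a definite part of its gauge used up by the members of `C` that meet it, then the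
content of `E` in the ball is controlled by the mass of the members of `C` near the ball. -/
lemma IsDoubling.content_inter_closedBall_le (hξ : ξ.IsDoubling D) {C : Set (MetricBall X)}
    {E : Set X} (hE : IsOpen E) {y : X} {s β : ℝ} (hs : 0 < s) (hβ : 0 < β)
    (hgood : ∀ c ∈ meeting C (closedBall y (2 * s)), 2 * c.radius ≤ s)
    (hneg : ∀ x ∈ E ∩ closedBall y s, ∀ r, 0 < r → r ≤ s → closedBall x r ⊆ E →
      (∃ c ∈ meeting C (closedBall x r), r < c.radius) ∨
        ENNReal.ofReal (β * ξ.val x r) ≤ ξ.mass (meeting C (closedBall x r))) :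
    ξ.content s (E ∩ closedBall y s) ≤
      ENNReal.ofReal (D + D ^ 4 * β⁻¹) * ξ.mass (meeting C (closedBall y (2 * s))) := by
  have hD : 0 ≤ D := zero_le_one.trans (hξ.one_le y)
  set N := meeting C (closedBall y (2 * s))
  have hex : ∀ x : X, ∃ r : ℝ, 0 < r ∧ 16 * r ≤ s ∧ (x ∈ E → closedBall x r ⊆ E) := by
    intro x
    by_cases hx : x ∈ E
    · obtain ⟨ε, hε, hεE⟩ := Metric.isOpen_iff.1 hE x hx
      refine ⟨min (ε / 2) (s / 16), by positivity, ?_, fun _ => ?_⟩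
      · linarith [min_le_right (ε / 2) (s / 16)]
      · exact (closedBall_subset_ball (by linarith [min_le_left (ε / 2) (s / 16)])).trans hεE
    · exact ⟨s / 16, by positivity, by linarith, fun h => absurd h hx⟩
  choose r hr hrs hrE using hex
  have hsubN : ∀ x ∈ closedBall y s, meeting C (closedBall x (r x)) ⊆ N := fun x hx =>
    meeting_mono C (closedBall_subset_closedBall' (by
      have := mem_closedBall.1 hx
      linarith [hrs x, hr x]))
  -- The two alternatives of `hneg`: points of `A₁` lie in doubled members of `N`; `A₂` needs the
  -- Vitali argument, with members no larger than the balls they meet.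
  let A₁ : Set X := {x ∈ E ∩ closedBall y s | ∃ c ∈ meeting C (closedBall x (r x)), r x < c.radius}
  let A₂ : Set X := {x ∈ E ∩ closedBall y s |
    ¬ ∃ c ∈ meeting C (closedBall x (r x)), r x < c.radius}
  have hA : E ∩ closedBall y s ⊆ A₁ ∪ A₂ := fun x hx => by
    by_cases h : ∃ c ∈ meeting C (closedBall x (r x)), r x < c.radius
    exacts [Or.inl ⟨hx, h⟩, Or.inr ⟨hx, h⟩]
  have h₁ : ξ.content s A₁ ≤ ENNReal.ofReal D * ξ.mass N := by
    calc ξ.content s A₁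
        ≤ ∑' c : N, ENNReal.ofReal (ξ.val c.1.center (2 * c.1.radius)) := by
          refine ξ.content_le_tsum (fun c : N => c.1.center) (fun c : N => 2 * c.1.radius)
            (fun c => by linarith [c.1.radius_pos]) (fun c => hgood c c.2) fun x hx => ?_
          obtain ⟨hx, c, hc, hrc⟩ := hx
          refine mem_iUnion.2 ⟨⟨c, hsubN x hx.2 hc⟩, ?_⟩
          have := dist_center_le_of_mem_meeting hc
          rw [mem_ball, dist_comm]
          show dist c.center x < 2 * c.radius
          linarith
      _ ≤ ∑' c : N, ENNReal.ofReal D * ENNReal.ofReal (ξ c) := by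
          refine ENNReal.tsum_le_tsum fun c => ?_
          have hc := c.1.radius_pos
          rw [← ENNReal.ofReal_mul hD, apply_eq_val]
          refine ENNReal.ofReal_le_ofReal ?_
          simpa using (hξ.val_le_pow c.1.center 1 hc (by linarith : c.1.radius ≤ 2 * c.1.radius)
            (by linarith)).2
      _ = ENNReal.ofReal D * ξ.mass N := ENNReal.tsum_mul_left
  have h₂ : ξ.content s A₂ ≤
      ENNReal.ofReal (D ^ 4) * ENNReal.ofReal β⁻¹ * ξ.mass N := by
    refine hξ.content_le_mul_tsum A₂ id r (fun x _ => hr x) (fun x _ => hrs x)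
      (fun c => ENNReal.ofReal (ξ c)) N (fun x => meeting C (closedBall x (r x)))
      (fun x hx => hsubN x hx.1.2) ?_ _ ?_ ?_
    · intro x hx c hc
      have h1 := dist_center_le_of_mem_meeting hc
      have h2 : c.radius ≤ r x := not_lt.1 fun h => hx.2 ⟨c, hc, h⟩
      show dist c.center x ≤ 3 * r x
      linarith [hr x]
    · intro x hx
      have h := (hneg x hx.1 (r x) (hr x) (by linarith [hrs x, hr x])
        (hrE x hx.1.1)).resolve_left hx.2
      calc ENNReal.ofReal (ξ.val x (r x))
          = ENNReal.ofReal β⁻¹ * ENNReal.ofReal (β * ξ.val x (r x)) := by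
            rw [← ENNReal.ofReal_mul (by positivity), inv_mul_cancel_left₀ hβ.ne']
        _ ≤ _ := by gcongr; exact h
    · intro x hx
      exact mem_iUnion₂.2 ⟨x, hx, mem_closedBall_self (hr x).le⟩
  calc ξ.content s (E ∩ closedBall y s) ≤ ξ.content s (A₁ ∪ A₂) := ξ.content_mono s hA
    _ ≤ _ := ξ.content_union_le s A₁ A₂
    _ ≤ _ := add_le_add h₁ h₂
    _ = _ := by
      rw [← add_mul, ENNReal.ofReal_add hD (by positivity), ENNReal.ofReal_mul (by positivity)]

/-- The balls of a collection, enlarged eight times, have small `ν`-content whenever the collection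
has small `ξ`-mass. -/
lemma DominatedBy.content_iUnion_ball_le (hdom : ν.DominatedBy ξ) (hξ : ξ.IsDoubling D)
    (hν : ν.IsDoubling D) {β : ℝ} {x₀ : X} {R : ℝ} {C : Set (MetricBall X)}
    (hsmall : ∀ c ∈ C, 16 * c.radius ≤ R) (hCx : ∀ c ∈ C, dist c.center x₀ ≤ 2 * R)
    (hmass : ξ.mass C < ENNReal.ofReal (β * ξ.val x₀ R)) :
    ν.content (R / 2) (⋃ c : C, ball c.1.center (8 * c.1.radius)) ≤
      ENNReal.ofReal (D ^ 7 * β * ν.val x₀ R) := by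
  have hD : 0 < D := one_pos.trans_le (hξ.one_le x₀)
  have hξ₀ := ξ.val_pos x₀ R
  have hν₀ := ν.val_pos x₀ R
  calc ν.content (R / 2) (⋃ c : C, ball c.1.center (8 * c.1.radius))
      ≤ ∑' c : C, ENNReal.ofReal (ν.val c.1.center (8 * c.1.radius)) :=
        ν.content_le_tsum (fun c : C => c.1.center) (fun c : C => 8 * c.1.radius)
          (fun c => by linarith [c.1.radius_pos]) (fun c => by linarith [hsmall c c.2]) subset_rfl
    _ ≤ ∑' c : C, ENNReal.ofReal (D ^ 7 * (ν.val x₀ R / ξ.val x₀ R)) * ENNReal.ofReal (ξ c) := by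
        refine ENNReal.tsum_le_tsum fun c => ?_
        have hc := c.1.radius_pos
        rw [← ENNReal.ofReal_mul (by positivity), apply_eq_val]
        refine ENNReal.ofReal_le_ofReal ?_
        calc ν.val c.1.center (8 * c.1.radius) ≤ D ^ 3 * ν.val c.1.center c.1.radius :=
              (hν.val_le_pow c.1.center 3 hc (by linarith) (by linarith)).2
          _ ≤ D ^ 3 * (D ^ 4 * (ν.val x₀ R / ξ.val x₀ R) * ξ.val c.1.center c.1.radius) := by
              gcongr
              exact hdom.val_mul_le hξ hν hc (by linarith [hsmall c c.2]) (hCx c c.2)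
          _ = _ := by ring
    _ = ENNReal.ofReal (D ^ 7 * (ν.val x₀ R / ξ.val x₀ R)) * ξ.mass C := ENNReal.tsum_mul_left
    _ ≤ ENNReal.ofReal (D ^ 7 * (ν.val x₀ R / ξ.val x₀ R)) *
          ENNReal.ofReal (β * ξ.val x₀ R) := by gcongr
    _ = _ := by
        rw [← ENNReal.ofReal_mul (by positivity)]
        congr 1
        field_simp

/-! ### Refinement step -/

/-- The refinement step: a ball of which a collection uses up only a small part of the gauge
contains a smaller ball with the same property that lies in a member of `𝓔 i`. -/
lemma exists_closedBall_subset_of_mass_lt (hξ : ξ.IsDoubling D) (hν : ν.IsDoubling D)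
    (hdom : ν.DominatedBy ξ) {Δ β : ℝ} (hΔ : 0 < Δ) (hβ : 0 < β) (hβD : β * D ^ 12 ≤ 1)
    (hβΔ : 4 * D ^ 8 * β ≤ Δ) {𝓔 : ℕ → Set (Set X)} {𝓑 : ℕ → Set (MetricBall X)} {U : Set X}
    (hopen : ∀ i, ∀ E ∈ 𝓔 i, IsOpen E) (hanti : ∀ i j, j ≤ i → 𝓔 i ⊆ 𝓔 j)
    (hclosed : ∀ i, ∀ B ∈ 𝓑 i, B.isClosed = true)
    (htransfer : ∀ i, ξ.IsTransferCollection ν (𝓔 i) (𝓑 i))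
    (hrad : Filter.Tendsto (fun i => MetricBall.rad (𝓑 i)) Filter.atTop (nhds 0))
    (hcontent : ∀ B : MetricBall X, B.carrier ⊆ U → ∀ i, ENNReal.ofReal (Δ * ν B) ≤
      ν.content B.radius (MetricBall.sUnion (MetricBall.restrict (𝓑 i) B.carrier B.radius)))
    (i : ℕ) {x₀ : X} {R : ℝ} (hR : 0 < R) (hU : ball x₀ R ⊆ U) {C : Set (MetricBall X)}
    (hCR : ∀ c ∈ C, c.radius ≤ R) (hCx : ∀ c ∈ C, dist c.center x₀ ≤ 2 * R)
    (hmass : ξ.mass C < ENNReal.ofReal (β * ξ.val x₀ R)) :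
    ∃ E ∈ 𝓔 i, ∃ (x : X) (r : ℝ), 0 < r ∧ r ≤ R / 2 ∧ closedBall x r ⊆ E ∩ ball x₀ R ∧
      (∀ c ∈ meeting C (closedBall x r), c.radius ≤ r) ∧
      ξ.mass (meeting C (closedBall x r)) < ENNReal.ofReal (β * ξ.val x r) := by
  by_contra! hneg
  have hD : 0 < D := one_pos.trans_le (hξ.one_le x₀)
  have hν₀ := ν.val_pos x₀ R
  -- A member of radius above `R / 16` would alone carry mass at least `β * ξ.val x₀ R`.
  have hsmall : ∀ c ∈ C, 16 * c.radius ≤ R := by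
    intro c hc
    by_contra! h
    refine hmass.not_ge (le_trans ?_ (ξ.le_mass hc))
    refine ENNReal.ofReal_le_ofReal ?_
    have h1 := hξ.val_le_of_dist_le hR h.le (hCR c hc) (hCx c hc)
    have h2 := ξ.val_pos c.center c.radius
    rw [apply_eq_val]
    calc β * ξ.val x₀ R ≤ β * (D ^ 12 * ξ.val c.center c.radius) := by gcongr
      _ = β * D ^ 12 * ξ.val c.center c.radius := by ring
      _ ≤ 1 * ξ.val c.center c.radius := by gcongr
      _ = ξ.val c.center c.radius := one_mul _
  set M : ℝ := D + D ^ 4 * β⁻¹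
  have hM0 : 0 < M := by positivity
  -- Makes `D ^ 4 * M * ε` a quarter of the contradicted bound, up to `D`. That `M` grows like `β⁻¹`
  -- is harmless, since `δ` and `j` are chosen afterwards.
  set ε : ℝ := Δ / (4 * D) * ν.val x₀ R / (D ^ 4 * M) with hε
  have hε0 : 0 < ε := by positivity
  obtain ⟨δ, hδ, hδmass⟩ := ξ.exists_mass_le_of_radius_le hmass.ne_top
    (ENNReal.ofReal_pos.2 hε0)
  have hτ : 0 < min δ (R / 32) := by positivity
  obtain ⟨j, hij, hj⟩ : ∃ j, i ≤ j ∧ MetricBall.rad (𝓑 j) < ENNReal.ofReal (min δ (R / 32)) :=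
    ((Filter.eventually_ge_atTop i).and
      (hrad.eventually (gt_mem_nhds (ENNReal.ofReal_pos.2 hτ)))).exists
  have hradius : ∀ B ∈ 𝓑 j, B.radius ≤ min δ (R / 32) := fun B hB =>
    (ENNReal.ofReal_le_ofReal_iff hτ.le).1 ((le_iSup₂ (f := fun (B : MetricBall X)
      (_ : B ∈ 𝓑 j) => ENNReal.ofReal B.radius) B hB).trans hj.le)
  -- The half radius leaves room for balls of radius at most `R / 32` about points of `B₀` to stay
  -- in `ball x₀ R`.
  let B₀ : MetricBall X := ⟨x₀, R / 2, by positivity, false⟩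
  have hB₀ : B₀.carrier = ball x₀ (R / 2) := by simp [B₀, carrier]
  have hlower := hcontent B₀ (by
    rw [hB₀]; exact (ball_subset_ball (by linarith)).trans hU) j
  set 𝓕 := MetricBall.restrict (𝓑 j) B₀.carrier B₀.radius
  let good : Set (MetricBall X) := {B ∈ 𝓕 |
    ∀ c ∈ meeting C (closedBall B.center (2 * B.radius)), 2 * c.radius ≤ B.radius}
  have hbound : ∀ B ∈ good, ENNReal.ofReal (ν.val B.center B.radius) ≤
      ENNReal.ofReal M * ξ.mass (meeting C (closedBall B.center (2 * B.radius))) := by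
    rintro B ⟨⟨hBj, -, hBB₀⟩, hBgood⟩
    obtain ⟨E, hE, hEB⟩ := htransfer j B hBj
    have hBc : B.carrier = closedBall B.center B.radius := by simp [carrier, hclosed j B hBj]
    rw [IsTransferBall, apply_eq_val, hBc] at hEB
    refine hEB.trans (hξ.content_inter_closedBall_le (hopen j E hE) B.radius_pos hβ hBgood ?_)
    intro x hx r hr hrB hrE
    rw [or_iff_not_imp_left]
    intro hno
    push Not at hno
    have hB32 := (hradius B hBj).trans (min_le_right _ _)
    refine hneg E (hanti j i hij hE) x r hr (by linarith) (subset_inter hrE ?_) hno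
    have hx₀ : x ∈ ball x₀ (R / 2) := hB₀ ▸ hBB₀ (hBc ▸ hx.2)
    exact closedBall_subset_ball' (by linarith [mem_ball.1 hx₀])
  have hgood : ν.content (R / 2) (⋃ B ∈ good, closedBall B.center B.radius) ≤
      ENNReal.ofReal (Δ / (4 * D) * ν.val x₀ R) := by
    have h := hν.content_le_mul_tsum good MetricBall.center MetricBall.radius (ρ := R / 2)
      (fun B _ => B.radius_pos)
      (fun B hB => by linarith [(hradius B hB.1.1).trans (min_le_right _ _)])
      (fun c => ENNReal.ofReal (ξ c)) {c ∈ C | c.radius ≤ δ}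
      (fun B => meeting C (closedBall B.center (2 * B.radius)))
      (fun B hB c hc => ⟨hc.1, by
        linarith [hB.2 c hc, c.radius_pos, (hradius B hB.1.1).trans (min_le_left _ _)]⟩)
      (fun B hB c hc => by
        linarith [dist_center_le_of_mem_meeting hc, hB.2 c hc, B.radius_pos, c.radius_pos])
      (ENNReal.ofReal M) hbound subset_rfl
    calc _ ≤ _ := h
      _ ≤ ENNReal.ofReal (D ^ 4) * ENNReal.ofReal M * ENNReal.ofReal ε := by
          exact mul_le_mul_right hδmass _
      _ = _ := by
          rw [← ENNReal.ofReal_mul (by positivity), ← ENNReal.ofReal_mul (by positivity)]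
          congr 1
          rw [hε]
          field_simp
  have hcover : MetricBall.sUnion 𝓕 ⊆ (⋃ c : C, ball c.1.center (8 * c.1.radius)) ∪
      ⋃ B ∈ good, closedBall B.center B.radius := by
    intro z hz
    obtain ⟨B, hB, hzB⟩ := mem_iUnion₂.1 hz
    have hzB' := B.carrier_subset_closedBall hzB
    by_cases hBg : B ∈ good
    · exact Or.inr (mem_iUnion₂.2 ⟨B, hBg, hzB'⟩)
    · obtain ⟨c, hc, hcB⟩ : ∃ c ∈ meeting C (closedBall B.center (2 * B.radius)),
          B.radius < 2 * c.radius := by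
        by_contra! h
        exact hBg ⟨hB, h⟩
      refine Or.inl (mem_iUnion.2 ⟨⟨c, hc.1⟩, mem_ball.2 ?_⟩)
      have h1 := dist_center_le_of_mem_meeting hc
      rw [dist_comm] at h1
      show dist z c.center < 8 * c.radius
      linarith [dist_triangle z B.center c.center, mem_closedBall.1 hzB', c.radius_pos]
  have hupper : ENNReal.ofReal (Δ * ν.val x₀ (R / 2)) ≤
      ENNReal.ofReal (D ^ 7 * β * ν.val x₀ R + Δ / (4 * D) * ν.val x₀ R) := by
    rw [ENNReal.ofReal_add (by positivity) (by positivity)]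
    rw [apply_eq_val] at hlower
    exact hlower.trans ((ν.content_mono _ hcover).trans ((ν.content_union_le _ _ _).trans
      (add_le_add (hdom.content_iUnion_ball_le hξ hν hsmall hCx hmass) hgood)))
  rw [ENNReal.ofReal_le_ofReal_iff (by positivity)] at hupper
  have hhalf : ν.val x₀ R ≤ D * ν.val x₀ (R / 2) := by
    simpa using (hν.val_le_pow x₀ 1 (r := R / 2) (s := R) (by positivity) (by linarith)
      (by linarith)).2
  -- Bad and good balls contribute at most a quarter each, by `hβΔ` and the choice of `ε`.
  have key : Δ * ν.val x₀ R ≤ Δ / 2 * ν.val x₀ R := by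
    calc Δ * ν.val x₀ R ≤ Δ * (D * ν.val x₀ (R / 2)) := by gcongr
      _ = D * (Δ * ν.val x₀ (R / 2)) := by ring
      _ ≤ D * (D ^ 7 * β * ν.val x₀ R + Δ / (4 * D) * ν.val x₀ R) := by gcongr
      _ = (4 * D ^ 8 * β + Δ) / 4 * ν.val x₀ R := by field_simp
      _ ≤ Δ / 2 * ν.val x₀ R :=
          mul_le_mul_of_nonneg_right (by linarith) hν₀.le
  nlinarith [mul_pos hΔ hν₀]

end Gauge

/-! ### Nested balls and the limit point -/

theorem theorem2p2 {X : Type*} [MetricSpace X] [CompleteSpace X] (D : ℝ) (ξ ν : Gauge X)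
    (hξ : ξ.IsDoubling D) (hν : ν.IsDoubling D) (hdom : ν.DominatedBy ξ)
    (Δ : ℝ) (hΔ : 0 < Δ) :
    ∃ β : ℝ, 0 < β ∧
      ∀ (𝓔 : ℕ → Set (Set X)) (𝓑 : ℕ → Set (MetricBall X)) (U : Set X),
        (∀ i, ∀ E ∈ 𝓔 i, IsOpen E) →
        (∀ i j, j ≤ i → 𝓔 i ⊆ 𝓔 j) →
        (∀ i, ∀ B ∈ 𝓑 i, B.isClosed = true) →
        (∀ i, ξ.IsTransferCollection ν (𝓔 i) (𝓑 i)) →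
        (∀ i j, j ≤ i → 𝓑 i ⊆ 𝓑 j) →
        Filter.Tendsto (fun i => MetricBall.rad (𝓑 i)) Filter.atTop (nhds 0) →
        IsOpen U →
        (∀ B : MetricBall X, B.carrier ⊆ U → ∀ i,
          ENNReal.ofReal (Δ * ν B) ≤
            ν.content B.radius
              (MetricBall.sUnion (MetricBall.restrict (𝓑 i) B.carrier B.radius))) →
        ∀ B : MetricBall X, B.carrier ⊆ U →
          ENNReal.ofReal (β * ξ B) ≤
            ξ.content B.radius (limsupCollections 𝓔 ∩ B.carrier) := by
  rcases isEmpty_or_nonempty X with hX | ⟨⟨o⟩⟩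
  · exact ⟨1, one_pos, fun _ _ _ _ _ _ _ _ _ _ _ B => (hX.false B.center).elim⟩
  have hD : 0 < D := one_pos.trans_le (hξ.one_le o)
  -- The first bound excludes large cover members; the second keeps the enlarged members'
  -- `ν`-content small against `Δ`.
  refine ⟨min (1 / D ^ 12) (Δ / (4 * D ^ 8)), by positivity, ?_⟩
  set β := min (1 / D ^ 12) (Δ / (4 * D ^ 8))
  have hβ : 0 < β := by positivity
  have hβD : β * D ^ 12 ≤ 1 := (le_div_iff₀ (by positivity)).1 (min_le_left _ _)
  have hβΔ : 4 * D ^ 8 * β ≤ Δ := by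
    rw [mul_comm]
    exact (le_div_iff₀ (by positivity)).1 (min_le_right _ _)
  intro 𝓔 𝓑 U hopen hanti hclosed htransfer _ hrad _ hcontent B hBU
  refine le_iInf fun 𝓒 => le_iInf fun h𝓒 => le_iInf fun hcov => ?_
  by_contra! hlt
  rw [Gauge.apply_eq_val] at hlt
  let State : Type _ := {p : X × ℝ // 0 < p.2 ∧ Metric.ball p.1 p.2 ⊆ U ∧
    (∀ c ∈ MetricBall.meeting 𝓒 (Metric.closedBall p.1 p.2), c.radius ≤ p.2) ∧
    ξ.mass (MetricBall.meeting 𝓒 (Metric.closedBall p.1 p.2)) < ENNReal.ofReal (β * ξ.val p.1 p.2)}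
  have hstep : ∀ (i : ℕ) (p : State), ∃ q : State, q.1.2 ≤ p.1.2 / 2 ∧
      Metric.closedBall q.1.1 q.1.2 ⊆ Metric.ball p.1.1 p.1.2 ∧
      ∃ E ∈ 𝓔 i, Metric.closedBall q.1.1 q.1.2 ⊆ E := by
    rintro i ⟨⟨x₀, R⟩, hR, hU, hCR, hmass⟩
    obtain ⟨E, hE, x, r, hr, hrR, hsub, hrad', hmass'⟩ :=
      Gauge.exists_closedBall_subset_of_mass_lt hξ hν hdom hΔ hβ hβD hβΔ hopen hanti hclosed
        htransfer hrad hcontent i hR hU hCR (fun c hc => by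
          have h1 := MetricBall.dist_center_le_of_mem_meeting hc
          have h2 := hCR c hc
          dsimp only at h1 h2
          linarith) hmass
    have hsub' := hsub.trans Set.inter_subset_right
    have hmeet : MetricBall.meeting 𝓒 (Metric.closedBall x r) ⊆ MetricBall.meeting
        (MetricBall.meeting 𝓒 (Metric.closedBall x₀ R)) (Metric.closedBall x r) := fun c hc =>
      ⟨MetricBall.meeting_mono 𝓒 (hsub'.trans Metric.ball_subset_closedBall) hc, hc.2⟩
    exact ⟨⟨⟨x, r⟩, hr, Metric.ball_subset_closedBall.trans (hsub'.trans hU),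
      fun c hc => hrad' c (hmeet hc), (ξ.mass_mono hmeet).trans_lt hmass'⟩, hrR, hsub',
      E, hE, hsub.trans Set.inter_subset_left⟩
  choose next hnext_rad hnext_ball hnext_mem using hstep
  -- The invariant on radii holds at the start because the content at scale `B.radius` admits only
  -- such covers.
  let p₀ : State := ⟨⟨B.center, B.radius⟩, B.radius_pos, B.ball_subset_carrier.trans hBU,
    fun c hc => (h𝓒 c hc.1).2, (ξ.mass_mono (Set.sep_subset _ _)).trans_lt hlt⟩
  let p : ℕ → State := fun n => Nat.rec p₀ next n
  have hball : ∀ n, Metric.closedBall (p (n + 1)).1.1 (p (n + 1)).1.2 ⊆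
      Metric.ball (p n).1.1 (p n).1.2 := fun n => hnext_ball n (p n)
  have hradp : ∀ n, (p n).1.2 ≤ B.radius * (1 / 2) ^ n := by
    intro n
    induction n with
    | zero => simp [p, p₀]
    | succ n ih =>
      have h : (p (n + 1)).1.2 ≤ (p n).1.2 / 2 := hnext_rad n (p n)
      rw [pow_succ]
      linarith
  have hnested : Antitone fun n => Metric.closedBall (p n).1.1 (p n).1.2 :=
    antitone_nat_of_succ_le fun n => (hball n).trans Metric.ball_subset_closedBall
  have hcauchy : CauchySeq fun n => (p n).1.1 := by
    refine cauchySeq_of_le_geometric (1 / 2) B.radius (by norm_num) fun n => ?_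
    have h := hball n (Metric.mem_closedBall_self (p (n + 1)).2.1.le)
    rw [dist_comm]
    exact (Metric.mem_ball.1 h).le.trans (hradp n)
  obtain ⟨z, hz⟩ := cauchySeq_tendsto_of_complete hcauchy
  have hzmem : ∀ n, z ∈ Metric.closedBall (p n).1.1 (p n).1.2 := fun n =>
    Metric.isClosed_closedBall.mem_of_tendsto hz (Filter.eventually_atTop.2
      ⟨n, fun m hm => hnested hm (Metric.mem_closedBall_self (p m).2.1.le)⟩)
  have hzlim : z ∈ limsupCollections 𝓔 := by
    intro n
    obtain ⟨E, hE, hsub⟩ := hnext_mem n (p n)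
    exact ⟨E, hE, hsub (hzmem (n + 1))⟩
  obtain ⟨c, hc, hzc⟩ := Set.mem_iUnion₂.1
    (hcov ⟨hzlim, B.ball_subset_carrier (hball 0 (hzmem 1))⟩)
  obtain ⟨n, hn⟩ := exists_pow_lt_of_lt_one (div_pos c.radius_pos B.radius_pos)
    (by norm_num : (1 / 2 : ℝ) < 1)
  rw [lt_div_iff₀ B.radius_pos] at hn
  have h := (p n).2.2.2.1 c ⟨hc, z, hzc, hzmem n⟩
  linarith [hradp n]
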